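/- Let $P$ be a set. A coloured $P$-multi-order $M$ is a many-sorted structure with one (possibly empty) sort $M_p$ for each $p\in P$, a binary relation $\leqslant_{p,q}$ on $M_p\times M_q$ for all $p,q\in P$, and arbitrarily many unary predicates (colours) on the sorts, such that each $\leqslant_{p,p}$ is a linear order on $M_p$ and the union of the relations $\leqslant_{p,q}$ is a linear (i.e. total) pre-order $\leqslant$ on the disjoint union of the sorts. Write $x<y$ if $x\leqslant y$ and not $y\leqslant x$. Write $M\preccurlyeq N$ if $M$ is an elementary substructure of $N$, in the sense of many-sorted first-order logic in the language consisting of the relations $\leqslant_{p,q}$ and the colours. Let $A,B$ be coloured $P$-multi-orders, in the same language, with $A\preccurlyeq B$. Consider the following substructures of $B$, where elements range over all sorts: $$\langle A\rangle_B=\{x\in B : \exists a,a'\in A\ (a\leqslant x\leqslant a')\}\quad\text{(convex hull)},$$ $$B_{\leqslant A}=\{x\in B : \forall a\in A\ (x<a)\}\cup\langle A\rangle_B\quad\text{(left hull)},$$ $$B_{\geqslant A}=\langle A\rangle_B\cup\{x\in B : \forall a\in A\ (a<x)\}\quad\text{(right hull)}.$$ Then: 1. $A\preccurlyeq\langle A\rangle_B\preccurlyeq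 B$; 2. $A\preccurlyeq B_{\leqslant A}\preccurlyeq B$; 3. $A\preccurlyeq B_{\geqslant A}\preccurlyeq B$. -/

import Mathlib

universe u v w w'

/-- A coloured `P`-multi-order: a many-sorted structure with one (possibly empty) sort `carrier p`
for each `p : P`, a relation `≤_{p,q}` between the sorts `p` and `q` for all `p q : P`, and unary
predicates (the colours), those on the sort `p` being indexed by `Col p`.  The union of the
relations `≤_{p,q}` is a linear (that is, total) pre-order on the disjoint union of the sorts, and
each `≤_{p,p}` is a linear order.  Reflexivity follows from totality. -/
structure ColouredMultiOrder (P : Type u) (Col : P → Type v) where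
  carrier : P → Type w
  le : ∀ {p q : P}, carrier p → carrier q → Prop
  colour : ∀ {p : P}, Col p → carrier p → Prop
  le_total : ∀ {p q : P} (x : carrier p) (y : carrier q), le x y ∨ le y x
  le_trans : ∀ {p q r : P} (x : carrier p) (y : carrier q) (z : carrier r),
    le x y → le y z → le x z
  le_antisymm : ∀ {p : P} (x y : carrier p), le x y → le y x → x = y

namespace ColouredMultiOrder

variable {P : Type u} {Col : P → Type v}

/-! ### Many-sorted first-order logic in the language of coloured `P`-multi-orders -/

/-- `Var Γ p` is the type of the variables of sort `p` in the context `Γ`, a finite list of sorts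
(de Bruijn indices). -/
inductive Var : List P → P → Type u
  | zero {Γ : List P} {p : P} : Var (p :: Γ) p
  | succ {Γ : List P} {p q : P} (x : Var Γ p) : Var (q :: Γ) p

/-- First-order formulas in the language of coloured `P`-multi-orders, with free variables in the
context `Γ`.  The other connectives and `∃` are definable from `⊥`, `→` and `∀`. -/
inductive Formula (Col : P → Type v) : List P → Type (max u v)
  | falsum {Γ : List P} : Formula Col Γ
  | eq {Γ : List P} {p : P} (x y : Var Γ p) : Formula Col Γ
  | le {Γ : List P} {p q : P} (x : Var Γ p) (y : Var Γ q) : Formula Col Γ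
  | colour {Γ : List P} {p : P} (c : Col p) (x : Var Γ p) : Formula Col Γ
  | imp {Γ : List P} (φ ψ : Formula Col Γ) : Formula Col Γ
  | all {Γ : List P} (p : P) (φ : Formula Col (p :: Γ)) : Formula Col Γ

/-- An assignment of elements of `M`, of the right sorts, to the variables of the context `Γ`. -/
abbrev Assignment (M : ColouredMultiOrder.{u, v, w} P Col) (Γ : List P) : Type (max u w) :=
  ∀ p : P, Var Γ p → M.carrier p

/-- Extension of an assignment by a value for a new variable of sort `p`. -/
def Assignment.cons {M : ColouredMultiOrder.{u, v, w} P Col} {Γ : List P} {p : P}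
    (a : M.carrier p) (s : M.Assignment Γ) : M.Assignment (p :: Γ)
  | _, Var.zero => a
  | _, Var.succ x => s _ x

/-- Satisfaction of a formula in `M` under an assignment; a quantifier over the sort `p` ranges
over `M.carrier p`. -/
def Formula.Realize (M : ColouredMultiOrder.{u, v, w} P Col) :
    {Γ : List P} → Formula Col Γ → M.Assignment Γ → Prop
  | _, .falsum, _ => False
  | _, .eq x y, s => s _ x = s _ y
  | _, .le x y, s => M.le (s _ x) (s _ y)
  | _, .colour c x, s => M.colour c (s _ x)
  | _, .imp φ ψ, s => φ.Realize M s → ψ.Realize M s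
  | _, .all p φ, s => ∀ a : M.carrier p, φ.Realize M (Assignment.cons a s)

/-- A sort-preserving map is elementary if it preserves and reflects the truth of every first-order
formula at every tuple. -/
def IsElementaryMap {M : ColouredMultiOrder.{u, v, w} P Col}
    {N : ColouredMultiOrder.{u, v, w'} P Col} (f : ∀ p : P, M.carrier p → N.carrier p) : Prop :=
  ∀ (Γ : List P) (φ : Formula Col Γ) (s : M.Assignment Γ),
    φ.Realize M s ↔ φ.Realize N (fun p x => f p (s p x))

/-! ### Substructures -/

/-- The underlying set of a substructure: a subset of each sort.  The language is relational, so
every such family carries a substructure. -/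
abbrev Sub (B : ColouredMultiOrder.{u, v, w} P Col) : Type (max u w) :=
  ∀ p : P, Set (B.carrier p)

/-- The structure induced by `B` on a family of subsets of its sorts. -/
def Sub.induced {B : ColouredMultiOrder.{u, v, w} P Col} (S : B.Sub) :
    ColouredMultiOrder.{u, v, w} P Col where
  carrier p := {x : B.carrier p // x ∈ S p}
  le x y := B.le x.1 y.1
  colour c x := B.colour c x.1
  le_total x y := B.le_total x.1 y.1
  le_trans x y z := B.le_trans x.1 y.1 z.1
  le_antisymm x y h h' := Subtype.ext (B.le_antisymm x.1 y.1 h h')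

/-- `S ≼ B`: the substructure `S` is an elementary substructure of the whole structure `B`. -/
def Sub.IsElementary {B : ColouredMultiOrder.{u, v, w} P Col} (S : B.Sub) : Prop :=
  IsElementaryMap (M := S.induced) (N := B) (fun _ x => x.1)

/-- `S ≼ T` for two substructures of `B`: `S` is contained in `T`, and it is an elementary
substructure of `T`. -/
def Sub.IsElementaryIn {B : ColouredMultiOrder.{u, v, w} P Col} (S T : B.Sub) : Prop :=
  ∃ h : ∀ p : P, S p ⊆ T p,
    IsElementaryMap (M := S.induced) (N := T.induced) (fun p x => ⟨x.1, h p x.2⟩)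

/-! ### Hulls -/

/-- The strict relation `x < y` of the linear pre-order, between elements of arbitrary sorts. -/
def lt (B : ColouredMultiOrder.{u, v, w} P Col) {p q : P} (x : B.carrier p) (y : B.carrier q) :
    Prop :=
  B.le x y ∧ ¬ B.le y x

/-- The convex hull `⟨A⟩_B` of `A` in `B`; the bounds may lie in any sorts. -/
def convexHull (B : ColouredMultiOrder.{u, v, w} P Col) (A : B.Sub) : B.Sub := fun p =>
  {x : B.carrier p | ∃ (q r : P) (a : B.carrier q) (a' : B.carrier r),
    a ∈ A q ∧ a' ∈ A r ∧ B.le a x ∧ B.le x a'}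

/-- `B_{<A}`, the set of the elements strictly below all elements of `A`. -/
def strictlyBelow (B : ColouredMultiOrder.{u, v, w} P Col) (A : B.Sub) : B.Sub := fun p =>
  {x : B.carrier p | ∀ (q : P) (a : B.carrier q), a ∈ A q → B.lt x a}

/-- `B_{>A}`, the set of the elements strictly above all elements of `A`. -/
def strictlyAbove (B : ColouredMultiOrder.{u, v, w} P Col) (A : B.Sub) : B.Sub := fun p =>
  {x : B.carrier p | ∀ (q : P) (a : B.carrier q), a ∈ A q → B.lt a x}

/-- The left hull `B_{≤A} = B_{<A} + ⟨A⟩_B` of `A` in `B`.  Every element of `B_{<A}` is strictly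
below every element of `⟨A⟩_B` (`lt_of_mem_strictlyBelow_of_mem_convexHull`), so the ordered sum of
these two substructures of `B` is the substructure of `B` on their union. -/
def leftHull (B : ColouredMultiOrder.{u, v, w} P Col) (A : B.Sub) : B.Sub := fun p =>
  B.strictlyBelow A p ∪ B.convexHull A p

/-- The right hull `B_{≥A} = ⟨A⟩_B + B_{>A}` of `A` in `B`.  Every element of `⟨A⟩_B` is strictly
below every element of `B_{>A}` (`lt_of_mem_convexHull_of_mem_strictlyAbove`), so the ordered sum of
these two substructures of `B` is the substructure of `B` on their union. -/
def rightHull (B : ColouredMultiOrder.{u, v, w} P Col) (A : B.Sub) : B.Sub := fun p =>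
  B.convexHull A p ∪ B.strictlyAbove A p

theorem lt_of_mem_strictlyBelow_of_mem_convexHull (B : ColouredMultiOrder.{u, v, w} P Col)
    (A : B.Sub) {p q : P} {x : B.carrier p} {y : B.carrier q} (hx : x ∈ B.strictlyBelow A p)
    (hy : y ∈ B.convexHull A q) : B.lt x y := by
  obtain ⟨r, _, a, _, ha, _, hay, _⟩ := hy
  exact ⟨B.le_trans _ _ _ (hx r a ha).1 hay, fun h => (hx r a ha).2 (B.le_trans _ _ _ hay h)⟩

theorem lt_of_mem_convexHull_of_mem_strictlyAbove (B : ColouredMultiOrder.{u, v, w} P Col)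
    (A : B.Sub) {p q : P} {x : B.carrier p} {y : B.carrier q} (hx : x ∈ B.convexHull A p)
    (hy : y ∈ B.strictlyAbove A q) : B.lt x y := by
  obtain ⟨_, r, _, a, _, ha, _, hxa⟩ := hx
  exact ⟨B.le_trans _ _ _ hxa (hy r a ha).1, fun h => (hy r a ha).2 (B.le_trans _ _ _ h hxa)⟩

end ColouredMultiOrder

/-! Each hull `S` is shown elementary in `B` by the Tarski–Vaught test; `A ≼ S` then follows from `A
≼ B` and `A ⊆ S`. Let `φ(b, s)` hold with parameters `s` in `S` and a witness `b` outside `S`. Then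
`b` lies strictly on one side of all of `A`, say above, and the finitely many parameters have a
common upper bound `e` in `A`. Hence `s ≤ e < b`, although `s` itself need not lie in `A`.

The main lemma is the Feferman–Vaught style composition `exists_agree_imp_realize_iff`. Elements not
above `e` compare in the same way with all elements above `e`, so for fixed `s` the truth of `φ(y,
s)` with `y > e` depends only on finitely many formulas in `(y, e)`. These are evaluated in all of
`B`, with `e` as a parameter, so nothing has to be relativized to the cut. One formula `θ(y, e)`
records their truth values at `b`. As `e` is in `A` and `A ≼ B`, some `a > e` in `A` satisfies `θ(a,
e)`, and then `φ(a, s)` holds. -/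

namespace ColouredMultiOrder

variable {P : Type u} {Col : P → Type v}

/-! ### Definable connectives -/

namespace Formula

/-- Negation. -/
def neg {Γ : List P} (φ : Formula Col Γ) : Formula Col Γ := .imp φ .falsum

/-- Conjunction. -/
def and {Γ : List P} (φ ψ : Formula Col Γ) : Formula Col Γ := neg (.imp φ (neg ψ))

/-- Existential quantification over the sort `p`. -/
def ex {Γ : List P} (p : P) (φ : Formula Col (p :: Γ)) : Formula Col Γ := neg (.all p (neg φ))

/-- The formula `x < y`. -/
def lt {Γ : List P} {p q : P} (x : Var Γ p) (y : Var Γ q) : Formula Col Γ :=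
  and (.le x y) (neg (.le y x))

variable {M : ColouredMultiOrder.{u, v, w} P Col} {Γ : List P}

theorem realize_neg {φ : Formula Col Γ} {s : M.Assignment Γ} :
    φ.neg.Realize M s ↔ ¬ φ.Realize M s := Iff.rfl

theorem realize_and {φ ψ : Formula Col Γ} {s : M.Assignment Γ} :
    (φ.and ψ).Realize M s ↔ φ.Realize M s ∧ ψ.Realize M s := by
  simp only [and, realize_neg, Realize]
  tauto

theorem realize_ex {p : P} {φ : Formula Col (p :: Γ)} {s : M.Assignment Γ} :
    (ex p φ).Realize M s ↔ ∃ a : M.carrier p, φ.Realize M (Assignment.cons a s) := by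
  simp only [ex, realize_neg, Realize, not_forall, not_not]

theorem realize_lt {p q : P} {x : Var Γ p} {y : Var Γ q} {s : M.Assignment Γ} :
    (lt x y : Formula Col Γ).Realize M s ↔ M.lt (s _ x) (s _ y) := by
  simp only [lt, realize_and, realize_neg, Realize, ColouredMultiOrder.lt]

end Formula

/-! ### Agreement on finite lists of formulas -/

/-- Two assignments agree on a list of formulas if they satisfy the same members of it. -/
def Agree (M : ColouredMultiOrder.{u, v, w} P Col) {Γ : List P} (Φ : List (Formula Col Γ))
    (s t : M.Assignment Γ) : Prop :=
  ∀ φ ∈ Φ, (φ.Realize M s ↔ φ.Realize M t)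

theorem Agree.symm {M : ColouredMultiOrder.{u, v, w} P Col} {Γ : List P}
    {Φ : List (Formula Col Γ)} {s t : M.Assignment Γ} (h : M.Agree Φ s t) : M.Agree Φ t s :=
  fun φ hφ => (h φ hφ).symm

/-- The complete types over a finite list of formulas form a finite list of formulas. -/
theorem exists_complete_types (M : ColouredMultiOrder.{u, v, w} P Col) {Γ : List P}
    (Φ : List (Formula Col Γ)) :
    ∃ Θ : List (Formula Col Γ), (∀ s : M.Assignment Γ, ∃ θ ∈ Θ, θ.Realize M s) ∧
      ∀ θ ∈ Θ, ∀ s t : M.Assignment Γ, θ.Realize M s → θ.Realize M t → M.Agree Φ s t := by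
  induction Φ with
  | nil => exact ⟨[Formula.neg .falsum], fun s => ⟨_, List.mem_singleton_self _, id⟩,
      fun _ _ _ _ _ _ _ h => by simp at h⟩
  | cons φ Φ ih =>
    obtain ⟨Θ, hcov, hagr⟩ := ih
    refine ⟨Θ.map (fun θ => θ.and φ) ++ Θ.map (fun θ => θ.and φ.neg), fun s => ?_, ?_⟩
    · obtain ⟨θ, hθ, hs⟩ := hcov s
      by_cases hφ : φ.Realize M s
      · exact ⟨θ.and φ, List.mem_append_left _ (List.mem_map.2 ⟨θ, hθ, rfl⟩),
          Formula.realize_and.2 ⟨hs, hφ⟩⟩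
      · exact ⟨θ.and φ.neg, List.mem_append_right _ (List.mem_map.2 ⟨θ, hθ, rfl⟩),
          Formula.realize_and.2 ⟨hs, hφ⟩⟩
    · intro χ hχ s t hs ht ψ hψ
      rw [List.mem_append, List.mem_map, List.mem_map] at hχ
      rcases hχ with ⟨θ, hθ, rfl⟩ | ⟨θ, hθ, rfl⟩ <;> rw [Formula.realize_and] at hs ht <;>
        rcases List.mem_cons.1 hψ with rfl | hψ
      · exact iff_of_true hs.2 ht.2
      · exact hagr θ hθ s t hs.1 ht.1 ψ hψ
      · exact iff_of_false hs.2 ht.2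
      · exact hagr θ hθ s t hs.1 ht.1 ψ hψ

/-! ### Composition over a definable cut -/

/-- A relation `R`, uniformly defined by formulas, such that for every `e` an element outside
`{y | R e y}` has the same position relative to all the elements of `{y | R e y}`. -/
structure DefinableCut (B : ColouredMultiOrder.{u, v, w} P Col) where
  rel : ∀ {p q : P}, B.carrier p → B.carrier q → Prop
  form : ∀ {Γ : List P} {p q : P}, Var Γ p → Var Γ q → Formula Col Γ
  realize_form : ∀ {Γ : List P} {p q : P} (x : Var Γ p) (y : Var Γ q)
    (s : B.Assignment Γ), (form x y).Realize B s ↔ rel (s _ x) (s _ y)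
  le_congr : ∀ {p q r : P} (e : B.carrier p) (x : B.carrier q) (y z : B.carrier r),
    ¬ rel e x → rel e y → rel e z → (B.le x y ↔ B.le x z) ∧ (B.le y x ↔ B.le z x)

/-- The cut `e < y`. -/
def upperCut (B : ColouredMultiOrder.{u, v, w} P Col) : B.DefinableCut where
  rel e y := B.lt e y
  form x y := Formula.lt x y
  realize_form _ _ _ := Formula.realize_lt
  le_congr e x y z hx hy hz := by
    have hxe : B.le x e := by
      rcases B.le_total x e with h | h
      · exact h
      · exact not_not.1 fun h' => hx ⟨h, h'⟩
    exact ⟨iff_of_true (B.le_trans _ _ _ hxe hy.1) (B.le_trans _ _ _ hxe hz.1),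
      iff_of_false (fun h => hy.2 (B.le_trans _ _ _ h hxe))
        (fun h => hz.2 (B.le_trans _ _ _ h hxe))⟩

/-- The cut `y < e`. -/
def lowerCut (B : ColouredMultiOrder.{u, v, w} P Col) : B.DefinableCut where
  rel e y := B.lt y e
  form x y := Formula.lt y x
  realize_form _ _ _ := Formula.realize_lt
  le_congr e x y z hx hy hz := by
    have hex : B.le e x := by
      rcases B.le_total e x with h | h
      · exact h
      · exact not_not.1 fun h' => hx ⟨h, h'⟩
    exact ⟨iff_of_false (fun h => hy.2 (B.le_trans _ _ _ hex h))
        (fun h => hz.2 (B.le_trans _ _ _ hex h)),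
      iff_of_true (B.le_trans _ _ _ hy.1 hex) (B.le_trans _ _ _ hz.1 hex)⟩

namespace DefinableCut

variable {B : ColouredMultiOrder.{u, v, w} P Col}

/-- The assignments `s` and `s'` to `Γ` coincide, with values outside `{y | R e y}`, on the
variables where `f` is undefined, and are given, with values in `{y | R e y}`, by `t` and `t'` on
the variables which `f` sends to variables of `Δ`. -/
def Splits (R : B.DefinableCut) {r : P} (e : B.carrier r) {Γ Δ : List P}
    (f : ∀ p : P, Var Γ p → Option (Var Δ p)) (s s' : B.Assignment Γ) (t t' : B.Assignment Δ) :
    Prop :=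
  ∀ (p : P) (x : Var Γ p),
    (f p x = none ∧ ¬ R.rel e (s p x) ∧ s' p x = s p x) ∨
    ∃ y, f p x = some y ∧ R.rel e (t p y) ∧ R.rel e (t' p y) ∧ s p x = t p y ∧ s' p x = t' p y

variable {R : B.DefinableCut} {r : P} {e : B.carrier r} {Γ Δ : List P}
  {f : ∀ p : P, Var Γ p → Option (Var Δ p)} {s s' : B.Assignment Γ} {t t' : B.Assignment Δ}

theorem Splits.symm (h : R.Splits e f s s' t t') : R.Splits e f s' s t' t := by
  intro p x
  rcases h p x with ⟨h1, h2, h3⟩ | ⟨y, h1, h2, h3, h4, h5⟩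
  · exact .inl ⟨h1, h3 ▸ h2, h3.symm⟩
  · exact .inr ⟨y, h1, h3, h2, h5, h4⟩

/-- Extension of `f` by a new variable outside the cut. -/
def extendNone (f : ∀ p : P, Var Γ p → Option (Var Δ p)) (q : P) :
    ∀ p : P, Var (q :: Γ) p → Option (Var Δ p)
  | _, .zero => none
  | _, .succ x => f _ x

/-- Extension of `f` by a new variable in the cut. -/
def extendSome (f : ∀ p : P, Var Γ p → Option (Var Δ p)) (q : P) :
    ∀ p : P, Var (q :: Γ) p → Option (Var (q :: Δ) p)
  | _, .zero => some .zero
  | _, .succ x => (f _ x).map .succ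

theorem Splits.extendNone (h : R.Splits e f s s' t t') {q : P} {a : B.carrier q}
    (ha : ¬ R.rel e a) :
    R.Splits e (extendNone f q) (Assignment.cons a s) (Assignment.cons a s') t t' := by
  intro p x
  cases x with
  | zero => exact .inl ⟨rfl, ha, rfl⟩
  | succ x => exact h p x

theorem Splits.extendSome (h : R.Splits e f s s' t t') {q : P} {a a' : B.carrier q}
    (ha : R.rel e a) (ha' : R.rel e a') :
    R.Splits e (extendSome f q) (Assignment.cons a s) (Assignment.cons a' s')
      (Assignment.cons a t) (Assignment.cons a' t') := by
  intro p x
  cases x with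
  | zero => exact .inr ⟨.zero, rfl, ha, ha', rfl, rfl⟩
  | succ x =>
    rcases h p x with ⟨h1, h2⟩ | ⟨y, h1, h2⟩
    · exact .inl ⟨by simp [DefinableCut.extendSome, h1], h2⟩
    · exact .inr ⟨.succ y, by simp [DefinableCut.extendSome, h1], h2⟩

theorem Splits.eq_iff {p : P} (h : R.Splits e f s s' t t') (x y : Var Γ p)
    (hxy : ∀ x' y', f p x = some x' → f p y = some y' →
      (t p x' = t p y' ↔ t' p x' = t' p y')) :
    s p x = s p y ↔ s' p x = s' p y := by
  rcases h p x with ⟨_, h2, h3⟩ | ⟨x', h1, h2, h3, h4, h5⟩ <;>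
    rcases h p y with ⟨_, k2, k3⟩ | ⟨y', k1, k2, k3, k4, k5⟩
  · rw [h3, k3]
  · rw [h3, k4, k5]
    -- An element outside the cut never equals one inside it.
    exact iff_of_false (fun h => h2 (h ▸ k2)) (fun h => h2 (h ▸ k3))
  · rw [k3, h4, h5]
    exact iff_of_false (fun h => k2 (h ▸ h2)) (fun h => k2 (h ▸ h3))
  · rw [h4, h5, k4, k5]
    exact hxy x' y' h1 k1

theorem Splits.le_iff {p q : P} (h : R.Splits e f s s' t t') (x : Var Γ p) (y : Var Γ q)
    (hxy : ∀ x' y', f p x = some x' → f q y = some y' →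
      (B.le (t p x') (t q y') ↔ B.le (t' p x') (t' q y'))) :
    B.le (s p x) (s q y) ↔ B.le (s' p x) (s' q y) := by
  rcases h p x with ⟨_, h2, h3⟩ | ⟨x', h1, h2, h3, h4, h5⟩ <;>
    rcases h q y with ⟨_, k2, k3⟩ | ⟨y', k1, k2, k3, k4, k5⟩
  · rw [h3, k3]
  · rw [h3, k4, k5]
    exact (R.le_congr e _ _ _ h2 k2 k3).1
  · rw [k3, h4, h5]
    exact (R.le_congr e _ _ _ k2 h2 h3).2
  · rw [h4, h5, k4, k5]
    exact hxy x' y' h1 k1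

theorem Splits.colour_iff {p : P} (h : R.Splits e f s s' t t') (c : Col p) (x : Var Γ p)
    (hx : ∀ x', f p x = some x' → (B.colour c (t p x') ↔ B.colour c (t' p x'))) :
    B.colour c (s p x) ↔ B.colour c (s' p x) := by
  rcases h p x with ⟨_, _, h3⟩ | ⟨x', h1, _, _, h4, h5⟩
  · rw [h3]
  · rw [h4, h5]
    exact hx x' h1

/-- Composition: for values of the remaining variables outside the cut at `e`, the truth of a
formula depends only on the truth of finitely many formulas about the values in the cut and `e`. -/
theorem exists_agree_imp_realize_iff (R : B.DefinableCut) {r : P} {Γ : List P}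
    (φ : Formula Col Γ) :
    ∀ (Δ : List P) (ε : Var Δ r) (f : ∀ p : P, Var Γ p → Option (Var Δ p)),
    ∃ Φ : List (Formula Col Δ), ∀ (s s' : B.Assignment Γ) (t t' : B.Assignment Δ),
      t r ε = t' r ε → R.Splits (t r ε) f s s' t t' → B.Agree Φ t t' →
      (φ.Realize B s ↔ φ.Realize B s') := by
  -- `Δ` and `f` stay universally quantified: a quantifier may add a variable to the cut side.
  induction φ with
  | falsum => exact fun Δ ε f => ⟨[], fun _ _ _ _ _ _ _ => Iff.rfl⟩
  | @eq Γ p x y =>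
    intro Δ ε f
    -- An atom with a variable outside the cut is already settled by `Splits`, so it needs no
    -- formula.
    rcases hx : f p x with _ | x'
    · exact ⟨[], fun s s' t t' _ h _ => h.eq_iff x y (by simp [hx])⟩
    rcases hy : f p y with _ | y'
    · exact ⟨[], fun s s' t t' _ h _ => h.eq_iff x y (by simp [hy])⟩
    refine ⟨[.eq x' y'], fun s s' t t' _ h hag => h.eq_iff x y ?_⟩
    intro x₁ y₁ h₁ h₂
    cases hx.symm.trans h₁
    cases hy.symm.trans h₂
    exact hag _ (List.mem_singleton_self _)
  | @le Γ p q x y =>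
    intro Δ ε f
    rcases hx : f p x with _ | x'
    · exact ⟨[], fun s s' t t' _ h _ => h.le_iff x y (by simp [hx])⟩
    rcases hy : f q y with _ | y'
    · exact ⟨[], fun s s' t t' _ h _ => h.le_iff x y (by simp [hy])⟩
    refine ⟨[.le x' y'], fun s s' t t' _ h hag => h.le_iff x y ?_⟩
    intro x₁ y₁ h₁ h₂
    cases hx.symm.trans h₁
    cases hy.symm.trans h₂
    exact hag _ (List.mem_singleton_self _)
  | @colour Γ p c x =>
    intro Δ ε f
    rcases hx : f p x with _ | x'
    · exact ⟨[], fun s s' t t' _ h _ => h.colour_iff c x (by simp [hx])⟩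
    refine ⟨[.colour c x'], fun s s' t t' _ h hag => h.colour_iff c x ?_⟩
    intro x₁ h₁
    cases hx.symm.trans h₁
    exact hag _ (List.mem_singleton_self _)
  | imp φ ψ ihφ ihψ =>
    intro Δ ε f
    obtain ⟨Φ, hΦ⟩ := ihφ Δ ε f
    obtain ⟨Ψ, hΨ⟩ := ihψ Δ ε f
    refine ⟨Φ ++ Ψ, fun s s' t t' he h hag => imp_congr (hΦ s s' t t' he h ?_)
      (hΨ s s' t t' he h ?_)⟩
    · exact fun χ hχ => hag χ (List.mem_append_left _ hχ)
    · exact fun χ hχ => hag χ (List.mem_append_right _ hχ)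
  | all p φ ih =>
    intro Δ ε f
    -- `Φ` handles a quantified value outside the cut, `Ψ` one inside it.
    obtain ⟨Φ, hΦ⟩ := ih Δ ε (DefinableCut.extendNone f p)
    obtain ⟨Ψ, hΨ⟩ := ih (p :: Δ) ε.succ (DefinableCut.extendSome f p)
    obtain ⟨Θ, hcov, hagr⟩ := exists_complete_types B Ψ
    -- One implication suffices, since `Splits` and `Agree` are symmetric.
    have key : ∀ (s s' : B.Assignment _) (t t' : B.Assignment Δ),
        t r ε = t' r ε → R.Splits (t r ε) f s s' t t' →
        B.Agree (Φ ++ Θ.map fun θ => Formula.ex p ((R.form ε.succ .zero).and θ)) t t' →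
        (Formula.all p φ).Realize B s → (Formula.all p φ).Realize B s' := by
      intro s s' t t' he h hag hs a'
      by_cases ha' : R.rel (t r ε) a'
      -- A back-and-forth step: the `Ψ`-type of `a'` over `t'` is realized inside the cut, and by
      -- agreement so it is over `t`.
      · obtain ⟨θ, hθ, hθa'⟩ := hcov (Assignment.cons a' t')
        have hex : (Formula.ex p ((R.form ε.succ .zero).and θ)).Realize B t :=
          (hag _ (List.mem_append_right _ (List.mem_map.2 ⟨θ, hθ, rfl⟩))).2
            (Formula.realize_ex.2 ⟨a', Formula.realize_and.2
              ⟨(R.realize_form _ _ _).2 (he ▸ ha' : R.rel (t' r ε) a'), hθa'⟩⟩)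
        obtain ⟨a, ha⟩ := Formula.realize_ex.1 hex
        rw [Formula.realize_and, R.realize_form] at ha
        exact (hΨ _ _ (Assignment.cons a t) (Assignment.cons a' t') he
          (h.extendSome ha.1 ha') (hagr θ hθ _ _ ha.2 hθa')).1 (hs a)
      -- Outside the cut, the same value serves on both sides.
      · exact (hΦ _ _ t t' he (h.extendNone ha')
          fun χ hχ => hag χ (List.mem_append_left _ hχ)).1 (hs a')
    exact ⟨_, fun s s' t t' he h hag => ⟨key s s' t t' he h hag,
      key s' s t' t he.symm (he ▸ h.symm) hag.symm⟩⟩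

/-- If all the parameters lie outside the cut at an element `e` of an elementary substructure `A`,
then a witness in the cut can be replaced by a witness in `A`. -/
theorem exists_mem_realize (R : B.DefinableCut) {A : B.Sub} (hA : A.IsElementary) {Γ : List P}
    {p r : P} (φ : Formula Col (p :: Γ)) {s : B.Assignment Γ} {e : B.carrier r} (he : e ∈ A r)
    (hs : ∀ (q : P) (x : Var Γ q), ¬ R.rel e (s q x)) {b : B.carrier p} (hb : R.rel e b)
    (hφ : φ.Realize B (Assignment.cons b s)) :
    ∃ a ∈ A p, φ.Realize B (Assignment.cons a s) := by
  -- Only the witness variable is in the cut; the second variable of `[p, r]` stands for `e`.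
  let f : ∀ q : P, Var (p :: Γ) q → Option (Var [p, r] q) :=
    DefinableCut.extendSome (fun _ _ => none) p
  obtain ⟨Φ, hΦ⟩ := R.exists_agree_imp_realize_iff φ [p, r] (.succ .zero) f
  obtain ⟨Θ, hcov, hagr⟩ := exists_complete_types B Φ
  let eA : A.induced.Assignment [r] :=
    Assignment.cons (M := A.induced) ⟨e, he⟩ (fun _ x => nomatch x)
  let eB : B.Assignment [r] := fun q x => (eA q x).1
  obtain ⟨θ, hθ, hθb⟩ := hcov (Assignment.cons b eB)
  have hex : (Formula.ex p ((R.form (.succ .zero) .zero).and θ)).Realize B eB :=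
    Formula.realize_ex.2 ⟨b, Formula.realize_and.2 ⟨(R.realize_form _ _ _).2 hb, hθb⟩⟩
  -- The only parameter left is `e`, which is in `A`, so elementarity applies.
  obtain ⟨a, ha⟩ := Formula.realize_ex.1 ((hA _ _ eA).2 hex)
  have ha' := (hA _ _ _).1 ha
  have hcons : (fun q x => (Assignment.cons a eA q x).1 : B.Assignment [p, r]) =
      Assignment.cons a.1 eB := by
    funext q x
    cases x <;> rfl
  rw [hcons, Formula.realize_and, R.realize_form] at ha'
  refine ⟨a.1, a.2, (hΦ _ _ (Assignment.cons b eB) (Assignment.cons a.1 eB) rfl ?_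
    (hagr θ hθ _ _ hθb ha'.2)).1 hφ⟩
  exact Splits.extendSome (fun q x => .inl ⟨rfl, hs q x, rfl⟩) hb ha'.1

end DefinableCut

/-! ### Elementary substructures -/

variable {B : ColouredMultiOrder.{u, v, w} P Col}

/-- The Tarski–Vaught test. -/
theorem Sub.isElementary_of_exists {S : B.Sub}
    (h : ∀ (Γ : List P) (p : P) (φ : Formula Col (p :: Γ)) (s : S.induced.Assignment Γ)
      (b : B.carrier p), φ.Realize B (Assignment.cons b fun q x => (s q x).1) →
      ∃ a ∈ S p, φ.Realize B (Assignment.cons a fun q x => (s q x).1)) :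
    S.IsElementary := by
  intro Γ φ
  induction φ with
  | falsum => exact fun s => Iff.rfl
  | eq x y => exact fun s => Subtype.ext_iff
  | le x y => exact fun s => Iff.rfl
  | colour c x => exact fun s => Iff.rfl
  | imp φ ψ ihφ ihψ => exact fun s => imp_congr (ihφ s) (ihψ s)
  | all p φ ih =>
    intro s
    have hcons : ∀ a : S.induced.carrier p, φ.Realize S.induced (Assignment.cons a s) ↔
        φ.Realize B (Assignment.cons a.1 fun q x => (s q x).1) := by
      intro a
      refine (ih (Assignment.cons a s)).trans (iff_of_eq (congrArg (φ.Realize B) ?_))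
      funext q x
      cases x <;> rfl
    constructor
    · intro hs b
      -- A counterexample in `B` is a witness for the negation, to which the test applies.
      by_contra hb
      obtain ⟨a, ha, hφ⟩ := h _ p φ.neg s b hb
      exact hφ ((hcons ⟨a, ha⟩).1 (hs ⟨a, ha⟩))
    · exact fun hs a => (hcons a).2 (hs a.1)

theorem Sub.IsElementary.isElementaryIn {S T : B.Sub} (hS : S.IsElementary) (hT : T.IsElementary)
    (h : ∀ p : P, S p ⊆ T p) : S.IsElementaryIn T :=
  ⟨h, fun Γ φ s => (hS Γ φ s).trans (hT Γ φ fun p x => ⟨(s p x).1, h p (s p x).2⟩).symm⟩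

/-- Provides a bound in `A` even when the tuple of parameters is empty. -/
theorem Sub.IsElementary.nonempty {A : B.Sub} (hA : A.IsElementary) {p : P} (b : B.carrier p) :
    (A p).Nonempty := by
  have h' := (hA [] (Formula.ex p (Formula.neg .falsum)) (fun _ x => nomatch x)).2
    (Formula.realize_ex.2 ⟨b, id⟩)
  obtain ⟨a, _⟩ := Formula.realize_ex.1 h'
  exact ⟨a.1, a.2⟩

/-- A finite tuple of elements bounded above by elements of `A` has a common bound in `A`. -/
theorem exists_mem_forall_le {A : B.Sub} {p : P} (hA : (A p).Nonempty) {Γ : List P}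
    (s : B.Assignment Γ)
    (hs : ∀ (q : P) (x : Var Γ q), ∃ (r : P) (a : B.carrier r), a ∈ A r ∧ B.le (s q x) a) :
    ∃ (r : P) (a : B.carrier r), a ∈ A r ∧ ∀ (q : P) (x : Var Γ q), B.le (s q x) a := by
  induction Γ with
  | nil => exact ⟨p, hA.some, hA.some_mem, fun _ x => nomatch x⟩
  | cons q Γ ih =>
    obtain ⟨r, a, ha, h⟩ := ih (fun q x => s q x.succ) fun q x => hs q x.succ
    obtain ⟨r', a', ha', h'⟩ := hs q .zero
    rcases B.le_total a a' with hle | hle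
    · refine ⟨r', a', ha', fun q x => ?_⟩
      cases x with
      | zero => exact h'
      | succ x => exact B.le_trans _ _ _ (h _ x) hle
    · refine ⟨r, a, ha, fun q x => ?_⟩
      cases x with
      | zero => exact B.le_trans _ _ _ h' hle
      | succ x => exact h _ x

/-- A finite tuple of elements bounded below by elements of `A` has a common bound in `A`. -/
theorem exists_mem_forall_ge {A : B.Sub} {p : P} (hA : (A p).Nonempty) {Γ : List P}
    (s : B.Assignment Γ)
    (hs : ∀ (q : P) (x : Var Γ q), ∃ (r : P) (a : B.carrier r), a ∈ A r ∧ B.le a (s q x)) :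
    ∃ (r : P) (a : B.carrier r), a ∈ A r ∧ ∀ (q : P) (x : Var Γ q), B.le a (s q x) := by
  induction Γ with
  | nil => exact ⟨p, hA.some, hA.some_mem, fun _ x => nomatch x⟩
  | cons q Γ ih =>
    obtain ⟨r, a, ha, h⟩ := ih (fun q x => s q x.succ) fun q x => hs q x.succ
    obtain ⟨r', a', ha', h'⟩ := hs q .zero
    rcases B.le_total a' a with hle | hle
    · refine ⟨r', a', ha', fun q x => ?_⟩
      cases x with
      | zero => exact h'
      | succ x => exact B.le_trans _ _ _ hle (h _ x)
    · refine ⟨r, a, ha, fun q x => ?_⟩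
      cases x with
      | zero => exact B.le_trans _ _ _ hle h'
      | succ x => exact h _ x

/-- A substructure containing the elementary substructure `A` is elementary if every element
outside it lies on a side of `A` on which `A` bounds the substructure. -/
theorem Sub.IsElementary.of_bounded {A S : B.Sub} (hA : A.IsElementary) (hAS : ∀ p : P, A p ⊆ S p)
    (h : ∀ (p : P) (b : B.carrier p), b ∉ S p → (A p).Nonempty →
      (b ∈ B.strictlyAbove A p ∧
        ∀ (q : P), ∀ x ∈ S q, ∃ (r : P) (a : B.carrier r), a ∈ A r ∧ B.le x a) ∨
      (b ∈ B.strictlyBelow A p ∧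
        ∀ (q : P), ∀ x ∈ S q, ∃ (r : P) (a : B.carrier r), a ∈ A r ∧ B.le a x)) :
    S.IsElementary := by
  refine Sub.isElementary_of_exists fun Γ p φ s b hφ => ?_
  by_cases hb : b ∈ S p
  · exact ⟨b, hb, hφ⟩
  have hne := hA.nonempty b
  suffices H : ∃ a ∈ A p, φ.Realize B (Assignment.cons a fun q x => (s q x).1) by
    obtain ⟨a, ha, hφa⟩ := H
    exact ⟨a, hAS p ha, hφa⟩
  -- The bound `e` in `A` separates the parameters from `b`, which is alone in the strict cut at
  -- `e`.
  rcases h p b hb hne with ⟨hab, hbd⟩ | ⟨hbl, hbd⟩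
  · obtain ⟨r, e, he, hs⟩ := exists_mem_forall_le hne (fun q x => (s q x).1)
      fun q x => hbd q _ (s q x).2
    exact B.upperCut.exists_mem_realize hA φ he (fun q x hlt => hlt.2 (hs q x)) (hab r e he) hφ
  · obtain ⟨r, e, he, hs⟩ := exists_mem_forall_ge hne (fun q x => (s q x).1)
      fun q x => hbd q _ (s q x).2
    exact B.lowerCut.exists_mem_realize hA φ he (fun q x hlt => hlt.2 (hs q x)) (hbl r e he) hφ

/-! ### Hulls -/

theorem le_of_not_lt {p q : P} {x : B.carrier p} {y : B.carrier q} (h : ¬ B.lt x y) :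
    B.le y x := by
  rcases B.le_total y x with h' | h'
  · exact h'
  · exact not_not.1 fun h'' => h ⟨h', h''⟩

theorem subset_convexHull (A : B.Sub) (p : P) : A p ⊆ B.convexHull A p := fun x hx =>
  ⟨p, p, x, x, hx, hx, (B.le_total x x).elim id id, (B.le_total x x).elim id id⟩

/-- By totality, failing to be above some `a'` and below some `a` gives `a ≤ b ≤ a'`. -/
theorem mem_strictlyAbove_or_mem_strictlyBelow {A : B.Sub} {p : P} {b : B.carrier p}
    (hb : b ∉ B.convexHull A p) : b ∈ B.strictlyAbove A p ∨ b ∈ B.strictlyBelow A p := by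
  by_contra! hcon
  simp only [strictlyAbove, strictlyBelow, Set.mem_ofPred_eq, not_forall] at hcon
  obtain ⟨⟨r, a', ha', h'⟩, ⟨q, a, ha, h⟩⟩ := hcon
  exact hb ⟨q, r, a, a', ha, ha', le_of_not_lt h, le_of_not_lt h'⟩

theorem exists_ge_of_mem_convexHull {A : B.Sub} {q : P} {x : B.carrier q}
    (hx : x ∈ B.convexHull A q) : ∃ (r : P) (a : B.carrier r), a ∈ A r ∧ B.le x a := by
  obtain ⟨_, r, _, a, _, ha, _, h⟩ := hx
  exact ⟨r, a, ha, h⟩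

theorem exists_le_of_mem_convexHull {A : B.Sub} {q : P} {x : B.carrier q}
    (hx : x ∈ B.convexHull A q) : ∃ (r : P) (a : B.carrier r), a ∈ A r ∧ B.le a x := by
  obtain ⟨r, _, a, _, ha, _, h, _⟩ := hx
  exact ⟨r, a, ha, h⟩

theorem Sub.IsElementary.convexHull {A : B.Sub} (hA : A.IsElementary) :
    (B.convexHull A).IsElementary :=
  hA.of_bounded (subset_convexHull A) fun _ _ hb _ =>
    (mem_strictlyAbove_or_mem_strictlyBelow hb).imp
      (fun h => ⟨h, fun _ _ => exists_ge_of_mem_convexHull⟩)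
      (fun h => ⟨h, fun _ _ => exists_le_of_mem_convexHull⟩)

/-- Only elements above `A` are missing, and `A` bounds the left hull from above: any element of `A`
bounds the part strictly below `A`. -/
theorem Sub.IsElementary.leftHull {A : B.Sub} (hA : A.IsElementary) :
    (B.leftHull A).IsElementary := by
  refine hA.of_bounded (fun p x hx => .inr (subset_convexHull A p hx)) fun p b hb hne => .inl
    ⟨(mem_strictlyAbove_or_mem_strictlyBelow fun h => hb (.inr h)).resolve_right
      fun h => hb (.inl h), ?_⟩
  rintro q x (hx | hx)
  · exact ⟨p, hne.some, hne.some_mem, (hx p _ hne.some_mem).1⟩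
  · exact exists_ge_of_mem_convexHull hx

theorem Sub.IsElementary.rightHull {A : B.Sub} (hA : A.IsElementary) :
    (B.rightHull A).IsElementary := by
  refine hA.of_bounded (fun p x hx => .inl (subset_convexHull A p hx)) fun p b hb hne => .inr
    ⟨(mem_strictlyAbove_or_mem_strictlyBelow fun h => hb (.inl h)).resolve_left
      fun h => hb (.inr h), ?_⟩
  rintro q x (hx | hx)
  · exact exists_le_of_mem_convexHull hx
  · exact ⟨p, hne.some, hne.some_mem, (hx p _ hne.some_mem).1⟩

end ColouredMultiOrder

theorem mainTheorem6 {P : Type u} {Col : P → Type v}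
    (B : ColouredMultiOrder.{u, v, w} P Col) (A : B.Sub) (hA : A.IsElementary) :
    (A.IsElementaryIn (B.convexHull A) ∧ (B.convexHull A).IsElementary) ∧
    (A.IsElementaryIn (B.leftHull A) ∧ (B.leftHull A).IsElementary) ∧
    (A.IsElementaryIn (B.rightHull A) ∧ (B.rightHull A).IsElementary) := by
  have hsub := ColouredMultiOrder.subset_convexHull A
  exact ⟨⟨hA.isElementaryIn hA.convexHull hsub, hA.convexHull⟩,
    ⟨hA.isElementaryIn hA.leftHull fun p x hx => .inr (hsub p hx), hA.leftHull⟩,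
    ⟨hA.isElementaryIn hA.rightHull fun p x hx => .inl (hsub p hx), hA.rightHull⟩⟩
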